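/- Work in the randomized independence-query model: an algorithm receives as input a finite set $V$, a number $t$, sets $B_1,\dots,B_t\subseteq V$ and real coefficients $\beta_1,\dots,\beta_t$; it has access to a matroid $\mathcal M=(V,\mathcal I)$ only through adaptive queries of the form "is $S\in\mathcal I$?" with $S\subseteq V$, it may flip coins with prescribed biases and draw uniform elements of finite sets, and it always terminates. The cost of a run is the number of its independence queries; computation between queries is not charged. For $f\colon 2^V\to\mathbb R$, let $$F(x)=\sum_{S\subseteq V} f(S)\prod_{v\in S}x_v\prod_{v\in V\setminus S}(1-x_v),\qquad x\in[0,1]^V,$$ be its multilinear extension; $f$ is submodular if $f(A)+f(B)\ge f(A\cup B)+f(A\cap B)$ for all $A,B\subseteq V$. **Theorem.** There are a randomized algorithm of this kind and an absolute constant $C$ such that the following holds for every matroid $\mathcal M=(V,\mathcal I)$ on a finite set $V$, with rank $r$, and every point $x=\sum_{i=1}^t\beta_i\mathbf 1_{B_i}$ represented as a convex combination of the characteristic vectors of $t$ bases $B_1,\dots,B_t$ of $\mathcal M$ ($\beta_i\ge 0$, $\sum_i\beta_i=1$). On input $V,t,(B_i),(\beta_i)$ and with the independence oracle of $\mathcal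 M$: - the output $S$ is a basis of $\mathcal M$ with probability 1; - $\mathbb E[f(S)]\ge F(x)$ for every submodular function $f\colon 2^V\to\mathbb R$ (the algorithm does not depend on $f$); - if $r\ge 1$, then with probability at least $1-(rt)^{-1}$ the algorithm uses at most $C\,r^{3/2}\,t\,\log^{3/2}(rt)$ independence queries. -/

import Mathlib

open scoped NNReal ENNReal

universe u

/-- A randomized oracle algorithm that returns a value of type `α` and may adaptively query a
`Bool`-valued oracle on inputs of type `Q`.  At each step it stops with an output, asks the oracle
one question, flips a coin with a prescribed bias, or draws a uniform element of `{0, …, n}`; how it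
continues may depend on the answer.  As the type is inductive, every run stops after finitely many
steps, whatever the oracle and the random choices are. -/
inductive OracleAlg (Q : Type*) (α : Type*) where
  | ret (a : α) : OracleAlg Q α
  | query (q : Q) (next : Bool → OracleAlg Q α) : OracleAlg Q α
  | coin (p : ℝ≥0) (hp : p ≤ 1) (next : Bool → OracleAlg Q α) : OracleAlg Q α
  | uniform (n : ℕ) (next : Fin (n + 1) → OracleAlg Q α) : OracleAlg Q α

/-- A coin that shows `true` with probability `p`. -/
noncomputable def coinPMF (p : ℝ≥0) (hp : p ≤ 1) : PMF Bool :=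
  PMF.ofFintype (fun b => if b then (p : ℝ≥0∞) else 1 - p) (by simp [hp])

namespace OracleAlg

/-- The joint distribution of the output and of the number of oracle queries made, when the
algorithm is run with the oracle `O`.  Only queries are counted. -/
noncomputable def run {Q α : Type*} (O : Q → Bool) : OracleAlg Q α → PMF (α × ℕ)
  | ret a => PMF.pure (a, 0)
  | query q next => (run O (next (O q))).map (fun o => (o.1, o.2 + 1))
  | coin p hp next => (coinPMF p hp).bind (fun b => run O (next b))
  | uniform n next => (PMF.uniformOfFintype (Fin (n + 1))).bind (fun i => run O (next i))

/-- The distribution of the output alone. -/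
noncomputable def output {Q α : Type*} (O : Q → Bool) (A : OracleAlg Q α) : PMF α :=
  (A.run O).map Prod.fst

end OracleAlg

/-- The expectation of `g` under a probability distribution on a finite type. -/
noncomputable def finExpectation {α : Type*} [Fintype α] (P : PMF α) (g : α → ℝ) : ℝ :=
  ∑ a, (P a).toReal * g a

open Classical in
/-- The independence oracle of a matroid: on input `S` it tells whether `S` is independent. -/
noncomputable def indepOracle {V : Type*} (M : Matroid V) (S : Finset V) : Bool :=
  decide (M.Indep (S : Set V))

def IsSubmodular {V : Type*} [DecidableEq V] (f : Finset V → ℝ) : Prop :=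
  ∀ A B : Finset V, f (A ∪ B) + f (A ∩ B) ≤ f A + f B

/-- The multilinear extension of a set function. -/
noncomputable def multilinearExt {V : Type*} [Fintype V] [DecidableEq V]
    (f : Finset V → ℝ) (x : V → ℝ) : ℝ :=
  ∑ S : Finset V, f S * ((∏ v ∈ S, x v) * ∏ v ∈ Sᶜ, (1 - x v))

/-- The characteristic vector of a set. -/
def charVec {V : Type*} [DecidableEq V] (S : Finset V) : V → ℝ :=
  fun v => if v ∈ S then 1 else 0

/-- A rounding algorithm.  From the ground set `V`, the number `t`, the sets `B i` and the
coefficients `β i`, it determines a randomized oracle algorithm with queries `S ⊆ V` and output a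
subset of `V`.  The matroid is not part of this data: the algorithm sees it through the oracle. -/
abbrev RoundingAlg :=
  ∀ (V : Type u) [Fintype V] [DecidableEq V] (t : ℕ), (Fin t → Finset V) → (Fin t → ℝ) →
    OracleAlg (Finset V) (Finset V)

/-! The bases are merged one at a time. A current basis `S` of weight `w` absorbs the next basis `T`
of weight `b` by random swaps, each of which shrinks `S \ T` by one, until both coincide and carry
weight `w + b`.

A swap uses `u, u' ∈ S \ T` and `v ∈ T \ S` such that `T - v + u` and `S - u' + v` are bases. The
second replaces `S` with probability `p = b / (w + b)`, otherwise the first replaces `T`. Since `p w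
= (1 - p) b`, the contributions of `v` cancel and the expected move of the point is a multiple of
`1_u - 1_{u'}`. If `u` is uniform in a set `C` permuted by `u ↦ u'`, the average move is zero. For
submodular `f` the extension `F` is convex along `1_v - 1_u`, so its expectation does not drop
(`multilinearExt_le_shift`, `le_mean_swapAlong`).

To find `C` cheaply, draw `k` elements `R` of `S \ T`. Every `u ∈ R` has a suitable `v`, and binary
search finds partners in `O(log r)` queries. If each such `v` has a partner `u' ∈ R`, then `u ↦ u'`
maps `R` to itself and permutes a nonempty subset. If some `v` has none, then with high probability
it has few partners in all of `S \ T`. Enumerating them meets a symmetric exchange, where `u' = u`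
and `C = {u}` (`ensures_circulate`).

A step thus costs `O(k log r)` queries except with probability `r exp(-k²/r)` (`overrun_swapStep`).
There are at most `rt` steps, and `k ≈ √(3 r log(rt))` gives the bound. -/

/-! ### Calculus of randomized oracle algorithms: expectations, sure properties, sampling. -/

namespace OracleAlg

variable {Q α β ι : Type*}

/-- Run one algorithm, then a second one that depends on the output of the first. -/
def bind : OracleAlg Q α → (α → OracleAlg Q β) → OracleAlg Q β
  | ret a, f => f a
  | query q next, f => query q fun b => (next b).bind f
  | coin p hp next, f => coin p hp fun b => (next b).bind f
  | uniform n next, f => uniform n fun i => (next i).bind f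

/-- The expectation of a function of the output and of the number of queries. -/
noncomputable def mean (O : Q → Bool) : OracleAlg Q α → (α → ℕ → ℝ) → ℝ
  | ret a, h => h a 0
  | query q next, h => mean O (next (O q)) fun a n => h a (n + 1)
  | coin p _ next, h => p * mean O (next true) h + (1 - p) * mean O (next false) h
  | uniform n next, h => (∑ i, mean O (next i) h) / (n + 1)

/-- Every run with the oracle `O` ends with an output and a number of queries satisfying `P`. -/
def Ensures (O : Q → Bool) : OracleAlg Q α → (α → ℕ → Prop) → Prop
  | ret a, P => P a 0
  | query q next, P => Ensures O (next (O q)) fun a n => P a (n + 1)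
  | coin _ _ next, P => ∀ b, Ensures O (next b) P
  | uniform _ next, P => ∀ i, Ensures O (next i) P

/-- The probability that more than `K` queries are made. -/
noncomputable def overrun (O : Q → Bool) (A : OracleAlg Q α) (K : ℕ) : ℝ :=
  mean O A fun _ n => if n ≤ K then 0 else 1

variable {O : Q → Bool}

theorem Ensures.mono {A : OracleAlg Q α} {P P' : α → ℕ → Prop} (hA : A.Ensures O P)
    (h : ∀ a n, P a n → P' a n) : A.Ensures O P' := by
  induction A generalizing P P' with
  | ret a => exact h _ _ hA
  | query q next ih => exact ih _ hA fun a n => h a (n + 1)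
  | coin p hp next ih => exact fun b => ih b (hA b) h
  | uniform n next ih => exact fun i => ih i (hA i) h

theorem Ensures.bind {A : OracleAlg Q α} {f : α → OracleAlg Q β} {P : β → ℕ → Prop}
    (hA : A.Ensures O fun a n => (f a).Ensures O fun b m => P b (n + m)) :
    (A.bind f).Ensures O P := by
  induction A generalizing P with
  | ret a => simpa [Ensures, OracleAlg.bind] using hA
  | query q next ih =>
    refine ih (O q) (P := fun a n => P a (n + 1)) ?_
    simpa only [Ensures, add_right_comm] using hA
  | coin p hp next ih => exact fun b => ih b (hA b)
  | uniform n next ih => exact fun i => ih i (hA i)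

theorem mean_bind (A : OracleAlg Q α) (f : α → OracleAlg Q β) (h : β → ℕ → ℝ) :
    (A.bind f).mean O h = A.mean O fun a n => (f a).mean O fun b m => h b (n + m) := by
  induction A generalizing h with
  | ret a => simp [mean, OracleAlg.bind]
  | query q next ih => simp [mean, OracleAlg.bind, ih, add_right_comm]
  | coin p hp next ih => simp [mean, OracleAlg.bind, ih]
  | uniform n next ih => simp [mean, OracleAlg.bind, ih]

theorem mean_mono {A : OracleAlg Q α} {h h' : α → ℕ → ℝ}
    (hA : A.Ensures O fun a n => h a n ≤ h' a n) : A.mean O h ≤ A.mean O h' := by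
  induction A generalizing h h' with
  | ret a => exact hA
  | query q next ih => exact ih _ hA
  | coin p hp next ih =>
    have hp' : (p : ℝ) ≤ 1 := by exact_mod_cast hp
    exact add_le_add (mul_le_mul_of_nonneg_left (ih true (hA true)) p.coe_nonneg)
      (mul_le_mul_of_nonneg_left (ih false (hA false)) (by linarith))
  | uniform n next ih =>
    exact div_le_div_of_nonneg_right (Finset.sum_le_sum fun i _ => ih i (hA i)) (by positivity)

theorem Ensures.of_forall (A : OracleAlg Q α) {P : α → ℕ → Prop} (h : ∀ a n, P a n) :
    A.Ensures O P := by
  induction A generalizing P with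
  | ret a => exact h _ _
  | query q next ih => exact ih _ fun a n => h a (n + 1)
  | coin p hp next ih => exact fun b => ih b h
  | uniform n next ih => exact fun i => ih i h

theorem mean_const (A : OracleAlg Q α) (c : ℝ) : (A.mean O fun _ _ => c) = c := by
  induction A with
  | ret a => rfl
  | query q next ih => exact ih _
  | coin p hp next ih => simp only [mean, ih]; ring
  | uniform n next ih =>
    simp only [mean, ih, Finset.sum_const, Finset.card_univ, Fintype.card_fin, nsmul_eq_mul]
    push_cast
    field_simp

theorem mean_add (A : OracleAlg Q α) (h h' : α → ℕ → ℝ) :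
    (A.mean O fun a n => h a n + h' a n) = A.mean O h + A.mean O h' := by
  induction A generalizing h h' with
  | ret a => rfl
  | query q next ih => exact ih _ _ _
  | coin p hp next ih => simp only [mean, ih]; ring
  | uniform n next ih => simp only [mean, ih, Finset.sum_add_distrib, add_div]

theorem mean_mul_const (A : OracleAlg Q α) (h : α → ℕ → ℝ) (c : ℝ) :
    (A.mean O fun a n => h a n * c) = A.mean O h * c := by
  induction A generalizing h with
  | ret a => rfl
  | query q next ih => exact ih _ _
  | coin p hp next ih => simp only [mean, ih]; ring
  | uniform n next ih => simp only [mean, ih, ← Finset.sum_mul]; ring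

theorem mean_sum (A : OracleAlg Q α) (s : Finset ι) (h : ι → α → ℕ → ℝ) :
    (A.mean O fun a n => ∑ j ∈ s, h j a n) = ∑ j ∈ s, A.mean O (h j) := by
  classical
  induction s using Finset.induction_on with
  | empty => simp [mean_const]
  | insert j s hj ih => simp only [Finset.sum_insert hj, mean_add, ih]

theorem le_mean {A : OracleAlg Q α} {h : α → ℕ → ℝ} {c : ℝ}
    (hA : A.Ensures O fun a n => c ≤ h a n) : c ≤ A.mean O h :=
  (mean_const A c).symm.le.trans (mean_mono hA)

theorem overrun_anti {A : OracleAlg Q α} {K K' : ℕ} (h : K ≤ K') :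
    A.overrun O K' ≤ A.overrun O K :=
  mean_mono (.of_forall _ fun a n => by split_ifs <;> first | omega | norm_num)

/-- Union bound: exceeding `K + K'` forces the first part to exceed `K` or the second to exceed
`K'`. -/
theorem overrun_bind_le {A : OracleAlg Q α} {f : α → OracleAlg Q β} {K K' : ℕ} {ε : ℝ}
    (hε : 0 ≤ ε) (hA : A.Ensures O fun a _ => (f a).overrun O K' ≤ ε) :
    (A.bind f).overrun O (K + K') ≤ A.overrun O K + ε := by
  rw [overrun, mean_bind, overrun]
  conv_rhs => rw [← mean_const (O := O) A ε, ← mean_add]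
  refine mean_mono (hA.mono fun a n ha => ?_)
  split_ifs with hn
  · rw [zero_add]
    refine (mean_mono (.of_forall _ fun b m => ?_)).trans ha
    split_ifs <;> first | omega | norm_num
  · refine (mean_mono (h' := fun _ _ => 1) (.of_forall _ fun b m => ?_)).trans ?_
    · split_ifs <;> norm_num
    · rw [mean_const]; linarith

theorem mean_nonneg {A : OracleAlg Q α} {h : α → ℕ → ℝ} (hh : ∀ a n, 0 ≤ h a n) :
    0 ≤ A.mean O h :=
  le_mean (.of_forall _ hh)

/-- The bridge from `PMF` to the recursive real-valued `mean`, in which the probabilistic estimates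
are carried out. -/
theorem toOuterMeasure_run (A : OracleAlg Q α) (s : Set (α × ℕ)) [∀ o, Decidable (o ∈ s)] :
    (A.run O).toOuterMeasure s =
      ENNReal.ofReal (A.mean O fun a n => if (a, n) ∈ s then 1 else 0) := by
  classical
  have nonneg : ∀ (B : OracleAlg Q α) (s : Set (α × ℕ)) [∀ o, Decidable (o ∈ s)],
      0 ≤ B.mean O fun a n => if (a, n) ∈ s then 1 else 0 := by
    intro B s _
    exact mean_nonneg fun a n => by split_ifs <;> norm_num
  induction A generalizing s with
  | ret a =>
    simp only [run, mean, PMF.toOuterMeasure_pure_apply]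
    split_ifs <;> simp
  | query q next ih =>
    rw [run, PMF.toOuterMeasure_map_apply, ih, mean]
    simp only [Set.mem_preimage]
  | coin p hp next ih =>
    have hp' : (p : ℝ) ≤ 1 := by exact_mod_cast hp
    rw [run, PMF.toOuterMeasure_bind_apply, tsum_fintype, Fintype.sum_bool, ih, ih, mean,
      ENNReal.ofReal_add (mul_nonneg p.coe_nonneg (nonneg _ _))
        (mul_nonneg (by linarith) (nonneg _ _)),
      ENNReal.ofReal_mul p.coe_nonneg, ENNReal.ofReal_mul (by linarith),
      ENNReal.ofReal_sub _ p.coe_nonneg]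
    simp [coinPMF]
  | uniform n next ih =>
    rw [run, PMF.toOuterMeasure_bind_apply, tsum_fintype, mean,
      ENNReal.ofReal_div_of_pos (by positivity), ENNReal.ofReal_sum_of_nonneg fun i _ => nonneg _ _,
      ENNReal.div_eq_inv_mul, Finset.mul_sum]
    refine Finset.sum_congr rfl fun i _ => ?_
    rw [ih]
    congr 1
    rw [PMF.uniformOfFintype_apply, Fintype.card_fin]
    congr 1
    rw [← Nat.cast_succ, ENNReal.ofReal_natCast]

theorem Ensures.of_mem_support {A : OracleAlg Q α} {P : α → ℕ → Prop} (hA : A.Ensures O P) :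
    ∀ o ∈ (A.run O).support, P o.1 o.2 := by
  induction A generalizing P with
  | ret a =>
    intro o ho
    rw [run, PMF.mem_support_pure_iff] at ho
    exact ho ▸ hA
  | query q next ih =>
    intro o ho
    rw [run, PMF.mem_support_map_iff] at ho
    obtain ⟨o', ho', rfl⟩ := ho
    exact ih _ hA _ ho'
  | coin p hp next ih =>
    intro o ho
    rw [run, PMF.mem_support_bind_iff] at ho
    obtain ⟨b, -, hb⟩ := ho
    exact ih b (hA b) _ hb
  | uniform n next ih =>
    intro o ho
    rw [run, PMF.mem_support_bind_iff] at ho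
    obtain ⟨i, -, hi⟩ := ho
    exact ih i (hA i) _ hi

theorem finExpectation_output [Fintype α] (A : OracleAlg Q α) (g : α → ℝ) :
    finExpectation (A.output O) g = A.mean O fun a _ => g a := by
  classical
  have hout : ∀ a, (A.output O a).toReal = A.mean O fun b _ => if b = a then 1 else 0 := by
    intro a
    rw [← PMF.toOuterMeasure_apply_singleton, output, PMF.toOuterMeasure_map_apply,
      toOuterMeasure_run, ENNReal.toReal_ofReal]
    · simp
    · exact mean_nonneg fun a n => by split_ifs <;> norm_num
  simp only [finExpectation, hout, ← mean_mul_const, ← mean_sum]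
  simp

theorem one_sub_overrun_le {A : OracleAlg Q α} {K : ℕ} {s : Set (α × ℕ)}
    (hs : ∀ o : α × ℕ, o.2 ≤ K → o ∈ s) :
    1 - A.overrun O K ≤ ((A.run O).toOuterMeasure s).toReal := by
  classical
  rw [toOuterMeasure_run, ENNReal.toReal_ofReal]
  · rw [sub_le_iff_le_add, overrun, ← mean_add]
    refine le_mean (.of_forall _ fun a n => ?_)
    by_cases hn : n ≤ K
    · simp [hn, hs (a, n) hn]
    · simp only [hn, if_false]
      split_ifs <;> norm_num
  · exact mean_nonneg fun a n => by split_ifs <;> norm_num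

/-- Draw a uniform element of a nonempty finite set. -/
noncomputable def uniformOn (D : Finset α) (hD : D.Nonempty) : OracleAlg Q α :=
  -- `uniform n` has `n + 1` outcomes.
  uniform (D.card - 1) fun i =>
    ret ((D.equivFinOfCardEq (Nat.succ_pred_eq_of_pos hD.card_pos).symm).symm i : α)

theorem ensures_uniformOn {D : Finset α} (hD : D.Nonempty) :
    (uniformOn D hD).Ensures O fun x n => x ∈ D ∧ n = 0 :=
  fun _ => ⟨Subtype.coe_prop _, rfl⟩

theorem mean_uniformOn {D : Finset α} (hD : D.Nonempty) (h : α → ℕ → ℝ) :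
    (uniformOn D hD).mean O h = (∑ x ∈ D, h x 0) / D.card := by
  have hc : ((D.card - 1 : ℕ) : ℝ) + 1 = D.card := by
    exact_mod_cast Nat.succ_pred_eq_of_pos hD.card_pos
  simp only [uniformOn, mean]
  rw [hc]
  congr 1
  rw [← Finset.sum_coe_sort D fun x => h x 0]
  exact Equiv.sum_comp (D.equivFinOfCardEq (Nat.succ_pred_eq_of_pos hD.card_pos).symm).symm
    (fun x : D => h (x : α) 0)

/-- Draw `k` independent uniform elements of a nonempty finite set. -/
noncomputable def sample (D : Finset α) (hD : D.Nonempty) : ℕ → OracleAlg Q (List α)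
  | 0 => ret []
  | k + 1 => (uniformOn D hD).bind fun x => (sample D hD k).bind fun R => ret (x :: R)

theorem ensures_sample {D : Finset α} (hD : D.Nonempty) (k : ℕ) :
    (sample D hD k).Ensures O fun R n => R.length = k ∧ (∀ x ∈ R, x ∈ D) ∧ n = 0 := by
  induction k with
  | zero => exact ⟨rfl, by simp, rfl⟩
  | succ k ih =>
    refine Ensures.bind ((ensures_uniformOn hD).mono fun x n hx => ?_)
    refine Ensures.bind (ih.mono fun R m hR => ?_)
    refine ⟨by simp [hR.1], ?_, by simp [hx.2, hR.2.2]⟩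
    simp only [List.mem_cons, forall_eq_or_imp]
    exact ⟨hx.1, hR.2.1⟩

open Classical in
theorem mean_sample_disjoint {D N : Finset α} (hD : D.Nonempty) (hN : N ⊆ D) (k : ℕ) :
    ((sample D hD k).mean O fun R _ => if ∃ x ∈ R, x ∈ N then 0 else 1) =
      (1 - (N.card : ℝ) / D.card) ^ k := by
  induction k with
  | zero => simp [sample, mean]
  | succ k ih =>
    have h : ∀ x : α, ((sample D hD k).mean O fun R _ =>
          if ∃ y ∈ x :: R, y ∈ N then (0 : ℝ) else 1) =
        (if x ∈ N then 0 else 1) * (1 - (N.card : ℝ) / D.card) ^ k := by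
      intro x
      by_cases hx : x ∈ N
      · simp [hx, mean_const]
      · rw [← ih]
        simp [hx]
    have hc : (D.card : ℝ) ≠ 0 := by exact_mod_cast hD.card_pos.ne'
    have hs : ∑ x ∈ D, (if x ∈ N then (0 : ℝ) else 1) = D.card - N.card := by
      rw [Finset.sum_ite, Finset.sum_const_zero, zero_add, Finset.sum_const, nsmul_one,
        ← Finset.sdiff_eq_filter, Finset.card_sdiff_of_subset hN,
        Nat.cast_sub (Finset.card_le_card hN)]
    simp only [sample, mean_bind]
    simp only [mean]
    rw [mean_uniformOn]
    simp only [h]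
    rw [← Finset.sum_mul, hs, pow_succ]
    field_simp

end OracleAlg

/-! ### Search by group testing. -/

namespace OracleAlg

variable {Q α : Type*} {O : Q → Bool}

/-- Binary search for a good element of a list, where the query `q L` tells whether `L` has one. -/
def search (q : List α → Q) : ℕ → List α → OracleAlg Q (Option α)
  | 0, L => ret L.head?
  | n + 1, L => query (q (L.take (L.length / 2))) fun b =>
      if b then search q n (L.take (L.length / 2)) else search q n (L.drop (L.length / 2))

/-- One query per halving suffices: a negative answer for the left half already places a good
element in the right half. -/
theorem ensures_search {q : List α → Q} {good : α → Prop} (n : ℕ) (L : List α)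
    (hq : ∀ L' ⊆ L, O (q L') = true ↔ ∃ x ∈ L', good x) (hL : L.length ≤ 2 ^ n)
    (hgood : ∃ x ∈ L, good x) :
    (search q n L).Ensures O fun o m => m ≤ n ∧ ∃ x ∈ L, o = some x ∧ good x := by
  induction n generalizing L with
  | zero =>
    obtain ⟨x, hx, hgx⟩ := hgood
    match L, hL with
    | [y], _ =>
      obtain rfl := List.mem_singleton.1 hx
      exact ⟨le_rfl, x, by simp, rfl, hgx⟩
  | succ n ih =>
    have hstep : ∀ L' ⊆ L, L'.length ≤ 2 ^ n → (∃ x ∈ L', good x) →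
        (search q n L').Ensures O fun o m =>
          m + 1 ≤ n + 1 ∧ ∃ x ∈ L, o = some x ∧ good x := fun L' hsub hlen hg =>
      (ih L' (fun M hM => hq M fun x hx => hsub (hM hx)) hlen hg).mono
        fun o m ⟨hm, x, hx, h⟩ => ⟨by omega, x, hsub hx, h⟩
    have htake : L.take (L.length / 2) ⊆ L := (List.take_sublist _ _).subset
    have hdrop : L.drop (L.length / 2) ⊆ L := (List.drop_sublist _ _).subset
    have hpow : 2 ^ (n + 1) = 2 * 2 ^ n := by ring
    simp only [search, Ensures]
    split_ifs with hb
    · exact hstep _ htake (by rw [List.length_take]; omega) ((hq _ htake).1 hb)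
    · refine hstep _ hdrop (by rw [List.length_drop]; omega) ?_
      obtain ⟨x, hx, hgx⟩ := hgood
      rw [← List.take_append_drop (L.length / 2) L, List.mem_append] at hx
      exact hx.elim (fun h => absurd ((hq _ htake).2 ⟨x, h, hgx⟩) hb) fun h => ⟨x, h, hgx⟩

/-- Find a good element of a list, if there is one. -/
def find (q : List α → Q) (L : List α) : OracleAlg Q (Option α) :=
  query (q L) fun b => if b then search q (Nat.clog 2 L.length) L else ret none

theorem ensures_find {q : List α → Q} {good : α → Prop} {L : List α} {c : ℕ}
    (hq : ∀ L' ⊆ L, O (q L') = true ↔ ∃ x ∈ L', good x) (hc : Nat.clog 2 L.length ≤ c) :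
    (find q L).Ensures O fun o m => m ≤ c + 1 ∧ (∀ x, o = some x → x ∈ L ∧ good x) ∧
      (o = none → ∀ x ∈ L, ¬ good x) := by
  simp only [find, Ensures]
  split_ifs with hb
  · refine (ensures_search _ L hq (Nat.le_pow_clog one_lt_two _)
      ((hq L (List.Subset.refl L)).1 hb)).mono ?_
    rintro o m ⟨hm, x, hx, rfl, hgx⟩
    refine ⟨by omega, ?_, by simp⟩
    rintro y ⟨⟩
    exact ⟨hx, hgx⟩
  · refine ⟨by omega, by simp, fun _ x hx hgx => hb ?_⟩
    exact (hq L (List.Subset.refl L)).2 ⟨x, hx, hgx⟩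

variable [DecidableEq α]

/-- Enumerate the good elements of a finite set until one passes the test `p`. -/
noncomputable def seek (q : List α → Q) (p : α → Q) : ℕ → Finset α → OracleAlg Q (Option α)
  | 0, _ => ret none
  | n + 1, D => (find q D.toList).bind fun
    | none => ret none
    | some x => query (p x) fun b => if b then ret (some x) else seek q p n (D.erase x)

-- Each round uncovers a new good element for at most `c + 1` queries plus one test. No round comes
-- up empty, because an element passing the test is still present.
open Classical in
theorem ensures_seek {q : List α → Q} {p : α → Q} {good : α → Prop} {c : ℕ} (n : ℕ)
    (D : Finset α) (hq : ∀ L : List α, (∀ x ∈ L, x ∈ D) → (O (q L) = true ↔ ∃ x ∈ L, good x))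
    (hc : Nat.clog 2 D.card ≤ c) (hn : D.card ≤ n) (hex : ∃ x ∈ D, good x ∧ O (p x) = true) :
    (seek q p n D).Ensures O fun o m => m ≤ (D.filter good).card * (c + 2) ∧
      ∃ x ∈ D, o = some x ∧ good x ∧ O (p x) = true := by
  induction n generalizing D with
  | zero =>
    obtain ⟨x, hx, -⟩ := hex
    simp [Finset.card_eq_zero.1 (Nat.le_zero.1 hn)] at hx
  | succ n ih =>
    refine Ensures.bind ((ensures_find (c := c) (good := good)
      (fun L hL => hq L fun x hx => by simpa using hL hx) (by simpa using hc)).mono ?_)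
    rintro (_ | x) m ⟨hm, h₁, h₂⟩
    · obtain ⟨x, hx, hgx, -⟩ := hex
      exact absurd hgx (h₂ rfl x (by simpa using hx))
    obtain ⟨hxD, hgx⟩ := h₁ x rfl
    rw [Finset.mem_toList] at hxD
    have hcard : (D.filter good).card = ((D.erase x).filter good).card + 1 := by
      rw [Finset.filter_erase, Finset.card_erase_add_one]
      exact Finset.mem_filter.2 ⟨hxD, hgx⟩
    simp only [Ensures]
    split_ifs with hb
    · exact ⟨by rw [hcard, add_mul]; omega, x, hxD, rfl, hgx, hb⟩
    · have hle : (D.erase x).card + 1 = D.card := Finset.card_erase_add_one hxD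
      refine (ih (D.erase x) (fun L hL => hq L fun y hy => Finset.mem_of_mem_erase (hL y hy))
        ((Nat.clog_mono_right 2 (by omega)).trans hc) (by omega) ?_).mono ?_
      · obtain ⟨y, hy, hgy, hpy⟩ := hex
        exact ⟨y, Finset.mem_erase.2 ⟨by rintro rfl; exact hb hpy, hy⟩, hgy, hpy⟩
      · rintro o k ⟨hk, y, hy, h⟩
        exact ⟨by rw [hcard, add_mul]; omega, y, Finset.mem_of_mem_erase hy, h⟩

end OracleAlg

/-! ### Basis exchange in matroids. -/

section Exchange

variable {V : Type*} {M : Matroid V}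

namespace Matroid

theorem IsBase.exists_symm_exchange {S T : Set V} (hS : M.IsBase S) (hT : M.IsBase T) {v : V}
    (hv : v ∈ T \ S) :
    ∃ u ∈ S \ T, M.Indep (insert v (S \ {u})) ∧ M.Indep (insert u (T \ {v})) := by
  have hvE : v ∈ M.E := hT.subset_ground hv.1
  have hC := hS.fundCircuit_isCircuit hvE hv.2
  -- If the rest of the fundamental circuit of `v` lay in the closure of `T - v`, so would `v`,
  -- contradicting the independence of `T`.
  obtain ⟨u, huC, huT⟩ : ∃ u ∈ M.fundCircuit v S \ {v}, u ∉ M.closure (T \ {v}) := by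
    by_contra! h
    exact hT.indep.notMem_closure_sdiff_of_mem hv.1
      (M.closure_subset_closure_of_subset_closure h
        (hC.mem_closure_sdiff_singleton_of_mem (M.mem_fundCircuit v S)))
  have huS : u ∈ S := (Set.mem_insert_iff.1 (M.fundCircuit_subset_insert v S huC.1)).resolve_left
    huC.2
  have huT' : u ∉ T := fun h => huT (M.subset_closure _ (Set.sdiff_subset.trans hT.subset_ground)
    ⟨h, huC.2⟩)
  refine ⟨u, ⟨huS, huT'⟩, ?_, ?_⟩
  · have := (hS.indep.mem_fundCircuit_iff (by rwa [hS.closure_eq]) hv.2).1 huC.1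
    rwa [Set.insert_sdiff_singleton_comm (Ne.symm huC.2)]
  · rw [(hT.indep.sdiff {v}).insert_indep_iff]
    exact .inl ⟨hS.subset_ground huS, huT⟩

/-- Both sides say that `L` meets the fundamental circuit of `y` in an element of `B`. Hence one
independence query tests a whole list of exchange partners, which makes binary search possible. -/
theorem IsBase.insert_sdiff_indep_iff {B L : Set V} (hB : M.IsBase B) {y : V}
    (hyE : y ∈ M.E) (hy : y ∉ B) :
    M.Indep (insert y (B \ L)) ↔ ∃ x ∈ L, M.Indep (insert y (B \ {x})) := by
  constructor
  · intro h
    have hC := hB.fundCircuit_isCircuit hyE hy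
    obtain ⟨x, hxC, hx⟩ := Set.not_subset.1 fun hsub => hC.not_indep (h.subset hsub)
    have hxy : x ≠ y := fun e => hx (e ▸ Set.mem_insert _ _)
    have hxB : x ∈ B := (Set.mem_insert_iff.1 (M.fundCircuit_subset_insert y B hxC)).resolve_left
      hxy
    refine ⟨x, by_contra fun hxL => hx (Set.mem_insert_of_mem _ ⟨hxB, hxL⟩), ?_⟩
    have := (hB.indep.mem_fundCircuit_iff (by rwa [hB.closure_eq]) hy).1 hxC
    rwa [Set.insert_sdiff_singleton_comm hxy.symm]
  · rintro ⟨x, hxL, hx⟩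
    exact hx.subset (Set.insert_subset_insert
      (Set.sdiff_subset_sdiff_right (Set.singleton_subset_iff.2 hxL)))

end Matroid

theorem indepOracle_eq_true {S : Finset V} : indepOracle M S = true ↔ M.Indep (S : Set V) := by
  simp [indepOracle]

variable [DecidableEq V]

/-- Exchanging `x` for `y` in `B` keeps it independent. -/
def Exchangeable (M : Matroid V) (B : Finset V) (x y : V) : Prop :=
  M.Indep (insert y (B.erase x) : Finset V)

theorem indepOracle_exchange_query (hE : M.E = Set.univ) {B : Finset V}
    (hB : M.IsBase (B : Set V)) {y : V} (hy : y ∉ B) (L : List V) :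
    indepOracle M (insert y (B \ L.toFinset)) = true ↔ ∃ x ∈ L, Exchangeable M B x y := by
  have h := hB.insert_sdiff_indep_iff (L := {x | x ∈ L}) (y := y) (by simp [hE]) (by simpa)
  rw [indepOracle_eq_true]
  simp only [Exchangeable, Finset.coe_insert, Finset.coe_sdiff, Finset.coe_erase,
    List.coe_toFinset]
  exact h

theorem Exchangeable.isBase {B : Finset V} {x y : V} (h : Exchangeable M B x y)
    (hB : M.IsBase (B : Set V)) (hy : y ∉ B) :
    M.IsBase (insert y (B.erase x) : Finset V) := by
  rw [Exchangeable, Finset.coe_insert, Finset.coe_erase] at h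
  rw [Finset.coe_insert, Finset.coe_erase]
  exact hB.exchange_isBase_of_indep (by simpa using hy) h

theorem exists_exchangeable {S T : Finset V} (hS : M.IsBase (S : Set V))
    (hT : M.IsBase (T : Set V)) {v : V} (hv : v ∈ T \ S) :
    ∃ u ∈ S \ T, Exchangeable M S u v ∧ Exchangeable M T v u := by
  obtain ⟨u, hu, h₁, h₂⟩ := hS.exists_symm_exchange hT (v := v) (by simpa using hv)
  exact ⟨u, by simpa using hu, by simpa [Exchangeable] using h₁, by simpa [Exchangeable] using h₂⟩

end Exchange

/-- A self-map of a nonempty finite set permutes a nonempty subset. -/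
theorem Finset.exists_nonempty_image_eq {α : Type*} [DecidableEq α] (R : Finset α) (φ : α → α)
    (hR : R.Nonempty) (hφ : R.image φ ⊆ R) : ∃ C ⊆ R, C.Nonempty ∧ C.image φ = C := by
  induction R using Finset.strongInduction with
  | H R ih =>
    rcases hφ.eq_or_ssubset with h | h
    · exact ⟨R, Finset.Subset.refl R, hR, h⟩
    · obtain ⟨C, hC, h'⟩ := ih _ h (hR.image φ) (Finset.image_subset_image hφ)
      exact ⟨C, hC.trans h.subset, h'⟩

/-! ### The multilinear extension and its convexity along exchange directions. -/

section Multilinear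

variable {V : Type*} [Fintype V] [DecidableEq V]

/-- The probability of `S` when every `v` is drawn independently with probability `x v`. -/
def prodWeight (x : V → ℝ) (S : Finset V) : ℝ :=
  ∏ v, if v ∈ S then x v else 1 - x v

theorem multilinearExt_eq (f : Finset V → ℝ) (x : V → ℝ) :
    multilinearExt f x = ∑ S, f S * prodWeight x S := by
  refine Finset.sum_congr rfl fun S _ => ?_
  rw [prodWeight, Finset.prod_ite, Finset.filter_mem_eq_inter, Finset.univ_inter,
    ← Finset.compl_filter, Finset.filter_mem_eq_inter, Finset.univ_inter]

theorem prodWeight_nonneg {x : V → ℝ} (h₀ : ∀ v, 0 ≤ x v) (h₁ : ∀ v, x v ≤ 1) (S : Finset V) :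
    0 ≤ prodWeight x S :=
  Finset.prod_nonneg fun v _ => by
    split_ifs
    · exact h₀ v
    · linarith [h₁ v]

theorem prodWeight_update (x : V → ℝ) (v : V) (a : ℝ) (S : Finset V) :
    prodWeight (Function.update x v a) S =
      (if v ∈ S then a else 1 - a) * ∏ w ∈ Finset.univ.erase v, if w ∈ S then x w else 1 - x w := by
  rw [prodWeight, ← Finset.mul_prod_erase _ _ (Finset.mem_univ v)]
  simp only [Function.update_self]
  congr 1
  refine Finset.prod_congr rfl fun w hw => ?_
  rw [Function.update_of_ne (Finset.ne_of_mem_erase hw)]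

theorem sum_eq_sum_insert_erase (v : V) (g : Finset V → ℝ) :
    ∑ S, g S = ∑ S ∈ Finset.univ.filter (v ∉ ·), (g S + g (insert v S)) := by
  rw [← Finset.sum_filter_not_add_sum_filter _ (v ∈ ·), Finset.sum_add_distrib]
  congr 1
  refine (Finset.sum_bij' (fun S _ => insert v S) (fun S _ => S.erase v) ?_ ?_ ?_ ?_ ?_).symm
  · simp
  · simp
  · intro S hS; simpa using hS
  · intro S hS; simpa using Finset.insert_erase (by simpa using hS)
  · simp

theorem multilinearExt_update (f : Finset V → ℝ) (x : V → ℝ) (v : V) (a : ℝ) :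
    multilinearExt f (Function.update x v a) =
      ∑ S, (a * f (insert v S) + (1 - a) * f (S.erase v)) * prodWeight x S := by
  rw [multilinearExt_eq, sum_eq_sum_insert_erase v, sum_eq_sum_insert_erase v]
  refine Finset.sum_congr rfl fun S hS => ?_
  have hv : v ∉ S := by simpa using hS
  have hprod : (∏ w ∈ Finset.univ.erase v, if w ∈ insert v S then x w else 1 - x w) =
      ∏ w ∈ Finset.univ.erase v, if w ∈ S then x w else 1 - x w :=
    Finset.prod_congr rfl fun w hw => by
      simp [Finset.mem_insert, Finset.ne_of_mem_erase hw]
  have hself : ∀ S, prodWeight x S = (if v ∈ S then x v else 1 - x v) *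
      ∏ w ∈ Finset.univ.erase v, if w ∈ S then x w else 1 - x w := fun S => by
    conv_lhs => rw [← Function.update_eq_self v x, prodWeight_update]
  rw [prodWeight_update, prodWeight_update, hself, hself, hprod]
  simp only [hv, if_false, Finset.mem_insert_self, if_true,
    Finset.insert_idem, Finset.erase_insert hv, Finset.erase_eq_of_notMem hv]
  ring

/-- Trading a move of the point for a change of the function keeps `x` fixed, so moves in two
coordinates compose by rewriting twice. -/
theorem multilinearExt_update_add (f : Finset V → ℝ) (x : V → ℝ) (v : V) (c : ℝ) :
    multilinearExt f (Function.update x v (x v + c)) =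
      multilinearExt (fun S => f S + c * (f (insert v S) - f (S.erase v))) x := by
  have hself : ∑ S, f S * prodWeight x S =
      ∑ S, (x v * f (insert v S) + (1 - x v) * f (S.erase v)) * prodWeight x S := by
    rw [← multilinearExt_update, Function.update_eq_self, multilinearExt_eq]
  rw [multilinearExt_update, multilinearExt_eq]
  simp only [add_mul _ _ (prodWeight x _), Finset.sum_add_distrib] at hself ⊢
  rw [hself, ← Finset.sum_add_distrib, ← Finset.sum_add_distrib, ← Finset.sum_add_distrib]
  exact Finset.sum_congr rfl fun S _ => by ring

/-- The partial derivative of the multilinear extension. -/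
noncomputable def partialDiff (f : Finset V → ℝ) (x : V → ℝ) (v : V) : ℝ :=
  ∑ S, (f (insert v S) - f (S.erase v)) * prodWeight x S

-- The mixed second difference of a submodular function is nonpositive.
omit [Fintype V] in
theorem IsSubmodular.insert_add_erase_le {f : Finset V → ℝ} (hf : IsSubmodular f) {u v : V}
    (huv : u ≠ v) (S : Finset V) :
    f (insert v (insert u S)) + f ((S.erase u).erase v) ≤
      f (insert v (S.erase u)) + f ((insert u S).erase v) := by
  have h := hf (insert v (S.erase u)) ((insert u S).erase v)
  have h₁ : insert v (S.erase u) ∪ (insert u S).erase v = insert v (insert u S) := by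
    ext w; by_cases hu : w = u <;> by_cases hv : w = v <;> simp [hu, hv, huv]
  have h₂ : insert v (S.erase u) ∩ (insert u S).erase v = (S.erase u).erase v := by
    ext w; by_cases hu : w = u <;> by_cases hv : w = v <;> simp [hu, hv, huv]
  rwa [h₁, h₂] at h

/-- The expansion in `c` is exact, with quadratic term `-c²` times the average mixed second
difference, which is nonnegative. Only `x` has to lie in the cube; the shifted point may leave it.
-/
theorem multilinearExt_le_shift {f : Finset V → ℝ} (hf : IsSubmodular f) {x : V → ℝ}
    (h₀ : ∀ v, 0 ≤ x v) (h₁ : ∀ v, x v ≤ 1) {u v : V} (huv : u ≠ v) (c : ℝ) :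
    multilinearExt f x + c * (partialDiff f x v - partialDiff f x u) ≤
      multilinearExt f (x + c • (Pi.single v 1 - Pi.single u 1)) := by
  have hx : x + c • (Pi.single v 1 - Pi.single u 1) =
      Function.update (Function.update x u (x u + -c)) v
        (Function.update x u (x u + -c) v + c) := by
    ext w
    rcases eq_or_ne w v with rfl | hwv
    · simp [huv.symm]
    · rcases eq_or_ne w u with rfl | hwu
      · simp [hwv]
      · simp [hwv, hwu]
  rw [hx, multilinearExt_update_add, multilinearExt_update_add, multilinearExt_eq,
    multilinearExt_eq, partialDiff, partialDiff, ← Finset.sum_sub_distrib, Finset.mul_sum,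
    ← Finset.sum_add_distrib]
  refine Finset.sum_le_sum fun S _ => ?_
  rw [← sub_mul, ← mul_assoc, ← add_mul]
  refine mul_le_mul_of_nonneg_right ?_ (prodWeight_nonneg h₀ h₁ S)
  nlinarith [mul_nonneg (mul_self_nonneg c) (sub_nonneg.2 (hf.insert_add_erase_le huv S))]

theorem multilinearExt_charVec (f : Finset V → ℝ) (S : Finset V) :
    multilinearExt f (charVec S) = f S := by
  rw [multilinearExt_eq, Finset.sum_eq_single S]
  · rw [prodWeight, Finset.prod_eq_one, mul_one]
    intro v _
    by_cases hv : v ∈ S <;> simp [charVec, hv]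
  · intro T _ hT
    obtain ⟨v, hv⟩ : ∃ v, ¬ (v ∈ T ↔ v ∈ S) := by
      by_contra! h
      exact hT (Finset.ext h)
    rw [prodWeight, Finset.prod_eq_zero (Finset.mem_univ v), mul_zero]
    by_cases hT : v ∈ T <;> by_cases hS : v ∈ S <;> simp_all [charVec]
  · simp

omit [Fintype V] in
theorem charVec_exchange {S : Finset V} {u v : V} (hu : u ∈ S) (hv : v ∉ S) :
    charVec (insert v (S.erase u)) = charVec S + (Pi.single v 1 - Pi.single u 1) := by
  have huv : u ≠ v := fun h => hv (h ▸ hu)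
  ext w
  rcases eq_or_ne w v with rfl | hwv
  · simp [charVec, hv, huv.symm]
  · rcases eq_or_ne w u with rfl | hwu
    · simp [charVec, hwv, hu]
    · simp [charVec, hwv, hwu]

end Multilinear

/-! ### One random swap between two bases. -/

namespace OracleAlg

variable {V : Type*} [DecidableEq V] {M : Matroid V}

/-- For every `u` in a list, look for a `v` with `T - v + u` independent and then for a `u'` in `R`
with `S - u' + v` independent.  The result is the table of the pairs `(v, u')`, or the first `v`
that has no such `u'`. -/
noncomputable def tabulate (S T R : Finset V) :
    List V → OracleAlg (Finset V) (V ⊕ (V → V × V))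
  | [] => ret (.inr fun u => (u, u))
  | u :: L => (find (fun K => insert u (T \ K.toFinset)) (T \ S).toList).bind fun
    | none => ret (.inl u)
    | some v => (find (fun K => insert v (S \ K.toFinset)) R.toList).bind fun
      | none => ret (.inl v)
      | some u' => (tabulate S T R L).bind fun
        | .inl w => ret (.inl w)
        | .inr tb => ret (.inr (Function.update tb u (v, u')))

/-- Both `T - v + u` and `S - u' + v` are independent, where `p = (v, u')`. -/
structure IsSwap (M : Matroid V) (S T : Finset V) (u : V) (p : V × V) : Prop where
  mem : u ∈ S \ T
  fst_mem : p.1 ∈ T \ S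
  snd_mem : p.2 ∈ S \ T
  right : Exchangeable M T p.1 u
  left : Exchangeable M S p.2 p.1

theorem ensures_tabulate (hE : M.E = Set.univ) {S T R : Finset V} {c : ℕ}
    (hS : M.IsBase (S : Set V)) (hT : M.IsBase (T : Set V)) (hR : R ⊆ S \ T)
    (hcT : Nat.clog 2 (T \ S).card ≤ c) (hcR : Nat.clog 2 R.card ≤ c) (L : List V)
    (hL : ∀ u ∈ L, u ∈ S \ T) :
    (tabulate S T R L).Ensures (indepOracle M) fun res n => n ≤ L.length * (2 * (c + 1)) ∧
      (∀ v, res = .inl v → v ∈ T \ S ∧ ∀ x ∈ R, ¬ Exchangeable M S x v) ∧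
      ∀ tb, res = .inr tb → ∀ u ∈ L, IsSwap M S T u (tb u) ∧ (tb u).2 ∈ R := by
  induction L with
  | nil => exact ⟨le_of_eq (by simp), by simp, by simp⟩
  | cons u L ih =>
    have hu := hL u (by simp)
    have huT : u ∉ T := (Finset.mem_sdiff.1 hu).2
    refine Ensures.bind ((ensures_find (c := c) (fun K _ => indepOracle_exchange_query hE hT huT K)
      (by simpa using hcT)).mono ?_)
    rintro (_ | v) n₁ ⟨hn₁, h₁, h₁'⟩
    · obtain ⟨v, hv, h, -⟩ := exists_exchangeable hT hS hu
      exact absurd h (h₁' rfl v (by simpa using hv))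
    obtain ⟨hv, hvu⟩ := h₁ v rfl
    rw [Finset.mem_toList] at hv
    have hvS : v ∉ S := (Finset.mem_sdiff.1 hv).2
    refine Ensures.bind ((ensures_find (c := c) (fun K _ => indepOracle_exchange_query hE hS hvS K)
      (by simpa using hcR)).mono ?_)
    rintro (_ | u') n₂ ⟨hn₂, h₂, h₂'⟩
    · refine ⟨by rw [List.length_cons, add_mul]; omega, ?_, by simp⟩
      rintro w ⟨⟩
      exact ⟨hv, fun x hx => h₂' rfl x (by simpa using hx)⟩
    obtain ⟨hu', huv⟩ := h₂ u' rfl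
    rw [Finset.mem_toList] at hu'
    refine Ensures.bind ((ih fun x hx => hL x (List.mem_cons_of_mem _ hx)).mono ?_)
    rintro (w | tb) n₃ ⟨hn₃, h₃, h₃'⟩
    · exact ⟨by rw [List.length_cons, add_mul]; omega, by simpa using h₃ w rfl, by simp⟩
    · refine ⟨by rw [List.length_cons, add_mul]; omega, by simp, ?_⟩
      rintro tb' ⟨⟩ x hx
      rcases eq_or_ne x u with rfl | hxu
      · rw [Function.update_self]
        exact ⟨⟨hu, hv, hR hu', hvu, huv⟩, hu'⟩
      · rw [Function.update_of_ne hxu]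
        exact h₃' tb rfl x ((List.mem_cons.1 hx).resolve_left hxu)

/-- A nonempty set `C` with swaps `u ↦ (v, u')` such that `u ↦ u'` permutes `C`. -/
structure IsCirculation (M : Matroid V) (S T C : Finset V) (tb : V → V × V) : Prop where
  nonempty : C.Nonempty
  image_eq : C.image (fun u => (tb u).2) = C
  isSwap : ∀ u ∈ C, IsSwap M S T u (tb u)

theorem IsCirculation.sum_eq {S T C : Finset V} {tb : V → V × V}
    (h : IsCirculation M S T C tb) (g : V → ℝ) : ∑ u ∈ C, g (tb u).2 = ∑ u ∈ C, g u := by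
  conv_rhs => rw [← h.image_eq]
  refine (Finset.sum_image ?_).symm
  exact Finset.card_image_iff.1 (congrArg Finset.card h.image_eq)

/-- Find a circulation, with the help of a set `R ⊆ S \ T`. -/
noncomputable def circulate (S T R : Finset V) :
    OracleAlg (Finset V) (Finset V × (V → V × V)) :=
  open Classical in
  (tabulate S T R R.toList).bind fun
  | .inl v => (seek (fun K => insert v (S \ K.toFinset)) (fun u => insert u (T.erase v))
      (S \ T).card (S \ T)).bind fun
    -- Never reached when `S` and `T` are bases and `v ∈ T \ S`: symmetric exchange supplies a `u`.
    | none => ret (∅, fun u => (u, u))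
    | some u => ret ({u}, fun _ => (v, u))
  | .inr tb => ret (if h : ∃ C ⊆ R, C.Nonempty ∧ C.image (fun u => (tb u).2) = C
      then h.choose else ∅, tb)

-- Correctness is unconditional; only the cost depends on the sample. If `R` meets every partner set
-- of size at least `d`, a `v` without partner in `R` has at most `d` partners to enumerate.
open Classical in
theorem ensures_circulate (hE : M.E = Set.univ) {S T R : Finset V} {c d : ℕ}
    (hS : M.IsBase (S : Set V)) (hT : M.IsBase (T : Set V)) (hR : R ⊆ S \ T) (hR' : R.Nonempty)
    (hcS : Nat.clog 2 (S \ T).card ≤ c) (hcT : Nat.clog 2 (T \ S).card ≤ c) :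
    (circulate S T R).Ensures (indepOracle M) fun res n => IsCirculation M S T res.1 res.2 ∧
      ((∀ v ∈ T \ S, d ≤ ((S \ T).filter (Exchangeable M S · v)).card →
        ∃ x ∈ R, Exchangeable M S x v) → n ≤ R.card * (2 * (c + 1)) + d * (c + 2)) := by
  have hcR : Nat.clog 2 R.card ≤ c := (Nat.clog_mono_right 2 (Finset.card_le_card hR)).trans hcS
  refine Ensures.bind ((ensures_tabulate hE hS hT hR hcT hcR R.toList
    (fun u hu => hR (Finset.mem_toList.1 hu))).mono ?_)
  rintro (v | tb) n ⟨hn, hl, hr⟩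
  · obtain ⟨hv, hvR⟩ := hl v rfl
    have hvS : v ∉ S := (Finset.mem_sdiff.1 hv).2
    refine Ensures.bind ((ensures_seek (good := (Exchangeable M S · v)) (c := c) _ _
      (fun K _ => indepOracle_exchange_query hE hS hvS K) hcS le_rfl ?_).mono ?_)
    · obtain ⟨u, hu, h, h'⟩ := exists_exchangeable hS hT hv
      exact ⟨u, hu, h, indepOracle_eq_true.2 h'⟩
    · rintro o m ⟨hm, u, hu, rfl, huv, hvu⟩
      refine ⟨⟨by simp, by simp, ?_⟩, fun hgood => ?_⟩
      · simp only [Finset.mem_singleton, forall_eq]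
        exact ⟨hu, hv, hu, indepOracle_eq_true.1 hvu, huv⟩
      · have hlt : ((S \ T).filter (Exchangeable M S · v)).card ≤ d := by
          by_contra! h
          obtain ⟨x, hx, hxv⟩ := hgood v hv h.le
          exact hvR x hx hxv
        rw [Finset.length_toList] at hn
        exact add_le_add hn (hm.trans (Nat.mul_le_mul_right _ hlt))
  · have hsw := fun u hu => hr tb rfl u (Finset.mem_toList.2 hu)
    have hex : ∃ C ⊆ R, C.Nonempty ∧ C.image (fun u => (tb u).2) = C := by
      refine Finset.exists_nonempty_image_eq R _ hR' fun x hx => ?_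
      obtain ⟨u, hu, rfl⟩ := Finset.mem_image.1 hx
      exact (hsw u hu).2
    simp only [Ensures, dif_pos hex]
    obtain ⟨h₁, h₂, h₃⟩ := hex.choose_spec
    refine ⟨⟨h₂, h₃, fun u hu => (hsw u (h₁ hu)).1⟩, fun _ => ?_⟩
    rw [Finset.length_toList] at hn
    omega

/-- Perform a random swap of a circulation: in `S` with probability `p`, otherwise in `T`. -/
noncomputable def swapAlong (p : ℝ≥0) (hp : p ≤ 1) (S T C : Finset V) (tb : V → V × V) :
    OracleAlg (Finset V) (Finset V × Finset V) :=
  open Classical in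
  if hC : C.Nonempty then (uniformOn C hC).bind fun u => coin p hp fun b => ret <|
    if b then (insert (tb u).1 (S.erase (tb u).2), T) else (S, insert u (T.erase (tb u).1))
  else ret (S, T)

theorem ensures_swapAlong {p : ℝ≥0} {hp : p ≤ 1} {S T C : Finset V} {tb : V → V × V}
    (h : IsCirculation M S T C tb) (hS : M.IsBase (S : Set V)) (hT : M.IsBase (T : Set V))
    (O : Finset V → Bool) :
    (swapAlong p hp S T C tb).Ensures O fun o n => n = 0 ∧ M.IsBase (o.1 : Set V) ∧
      M.IsBase (o.2 : Set V) ∧ (o.1 \ o.2).card + 1 = (S \ T).card := by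
  rw [swapAlong, dif_pos h.nonempty]
  refine Ensures.bind ((ensures_uniformOn h.nonempty).mono ?_)
  rintro u n ⟨hu, rfl⟩ b
  obtain ⟨h₁, h₂, h₃, h₄, h₅⟩ := h.isSwap u hu
  rcases b with _ | _
  · refine ⟨rfl, hS, h₄.isBase hT (Finset.mem_sdiff.1 h₁).2, ?_⟩
    rw [← Finset.card_erase_add_one h₁]
    congr 2
    ext x
    have := Finset.mem_sdiff.1 h₂
    grind
  · refine ⟨rfl, h₅.isBase hS (Finset.mem_sdiff.1 h₂).2, hT, ?_⟩
    rw [← Finset.card_erase_add_one h₃]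
    congr 2
    ext x
    have := Finset.mem_sdiff.1 h₂
    grind

/-- One step of the merging of two bases: both stay bases and their difference shrinks by one. -/
noncomputable def swapStep (k : ℕ) (p : ℝ≥0) (hp : p ≤ 1) (S T : Finset V) :
    OracleAlg (Finset V) (Finset V × Finset V) :=
  open Classical in
  if h : (S \ T).Nonempty then
    (sample (S \ T) h k).bind fun R => (circulate S T R.toFinset).bind fun C =>
      swapAlong p hp S T C.1 C.2
  else ret (S, T)

section Step

variable {k r : ℕ} {p : ℝ≥0} {hp : p ≤ 1} {S T : Finset V}

theorem card_sdiff_eq_of_isBase (hS : M.IsBase (S : Set V)) (hT : M.IsBase (T : Set V)) :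
    (S \ T).card = (T \ S).card := by
  refine Finset.card_sdiff_comm ?_
  simpa using hS.ncard_eq_ncard_of_isBase hT

theorem ensures_sample_toFinset (hk : 0 < k) (h : (S \ T).Nonempty) (O : Finset V → Bool) :
    (sample (S \ T) h k).Ensures O fun R n =>
      R.toFinset ⊆ S \ T ∧ R.toFinset.Nonempty ∧ R.toFinset.card ≤ k ∧ n = 0 := by
  refine (ensures_sample h k).mono fun R n ⟨h₁, h₂, h₃⟩ => ⟨fun x hx => h₂ x (by simpa using hx),
    ?_, h₁ ▸ R.toFinset_card_le, h₃⟩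
  rw [List.toFinset_nonempty_iff]
  rintro rfl
  simp at h₁
  omega

theorem ensures_swapStep (hE : M.E = Set.univ) (hk : 0 < k)
    (hS : M.IsBase (S : Set V)) (hT : M.IsBase (T : Set V)) (h : (S \ T).Nonempty) :
    (swapStep k p hp S T).Ensures (indepOracle M) fun o _ => M.IsBase (o.1 : Set V) ∧
      M.IsBase (o.2 : Set V) ∧ (o.1 \ o.2).card + 1 = (S \ T).card := by
  rw [swapStep, dif_pos h]
  refine Ensures.bind ((ensures_sample_toFinset hk h _).mono fun R n hR => ?_)
  -- The cost is irrelevant here, so any `d` would do.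
  refine Ensures.bind ((ensures_circulate (d := 0) hE hS hT hR.1 hR.2.1 le_rfl
    (card_sdiff_eq_of_isBase hS hT ▸ le_rfl)).mono fun C m hC => ?_)
  exact (ensures_swapAlong hC.1 hS hT _).mono fun o _ ho => ho.2

/-- The budget can be exceeded only if the sample misses the partner set of some `v ∈ T \ S` with at
least `k` partners. For one `v` this has probability at most `(1 - k/r)^k ≤ exp(-k²/r)` when `k ≤
r`, and there are at most `r` choices of `v`. -/
theorem overrun_swapStep (hE : M.E = Set.univ) (hk : 0 < k)
    (hS : M.IsBase (S : Set V)) (hT : M.IsBase (T : Set V)) (hr : S.card = r)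
    (h : (S \ T).Nonempty) :
    (swapStep k p hp S T).overrun (indepOracle M) (k * (3 * Nat.clog 2 r + 4)) ≤
      r * Real.exp (-((k : ℝ) ^ 2 / r)) := by
  classical
  set c := Nat.clog 2 r
  set N : V → Finset V := fun v => (S \ T).filter (Exchangeable M S · v) with hN
  have hm : (S \ T).card ≤ r := hr ▸ Finset.card_le_card Finset.sdiff_subset
  have hcS : Nat.clog 2 (S \ T).card ≤ c := Nat.clog_mono_right 2 hm
  have hcT : Nat.clog 2 (T \ S).card ≤ c := card_sdiff_eq_of_isBase hS hT ▸ hcS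
  have hm0 : (0 : ℝ) < (S \ T).card := by exact_mod_cast h.card_pos
  have hmr : ((S \ T).card : ℝ) ≤ r := by exact_mod_cast hm
  rw [swapStep, dif_pos h, overrun, mean_bind]
  calc _ ≤ (sample (S \ T) h k).mean (indepOracle M) fun R _ =>
        ∑ v ∈ T \ S, if k ≤ (N v).card then (if ∃ x ∈ R, x ∈ N v then 0 else 1) else 0 := by
        refine mean_mono ((ensures_sample_toFinset hk h _).mono ?_)
        rintro R n ⟨hR, hR', hRk, rfl⟩
        have hnn : ∀ v ∈ T \ S, (0 : ℝ) ≤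
            if k ≤ (N v).card then (if ∃ x ∈ R, x ∈ N v then 0 else 1) else 0 := fun v _ => by
          split_ifs <;> norm_num
        by_cases hgood : ∀ v ∈ T \ S, k ≤ (N v).card → ∃ x ∈ R.toFinset, Exchangeable M S x v
        · refine le_trans ?_ (Finset.sum_nonneg hnn)
          refine (mean_mono (h' := fun _ _ => 0) ?_).trans (mean_const _ 0).le
          refine Ensures.bind ((ensures_circulate (d := k) hE hS hT hR hR' hcS hcT).mono
            fun C m hC => ?_)
          refine (ensures_swapAlong hC.1 hS hT _).mono fun o i ho => ?_
          have hle := hC.2 hgood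
          have := Nat.mul_le_mul_right (2 * (c + 1)) hRk
          rw [if_pos]
          rw [ho.1]
          calc _ = m := by ring
            _ ≤ k * (2 * (c + 1)) + k * (c + 2) := by omega
            _ = k * (3 * c + 4) := by ring
        · push Not at hgood
          obtain ⟨v, hv, hkv, hno⟩ := hgood
          refine le_trans ?_ (Finset.single_le_sum hnn hv)
          rw [if_pos hkv, if_neg]
          · refine (mean_mono (h' := fun _ _ => 1) (.of_forall _ fun a n => ?_)).trans
              (mean_const _ 1).le
            split_ifs <;> norm_num
          · rintro ⟨x, hx, hx'⟩
            exact hno x (by simpa using hx) (Finset.mem_filter.1 hx').2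
    _ ≤ ∑ v ∈ T \ S, Real.exp (-((k : ℝ) ^ 2 / r)) := by
        rw [mean_sum]
        refine Finset.sum_le_sum fun v _ => ?_
        split_ifs with hkv
        · have hN' : N v ⊆ S \ T := Finset.filter_subset _ _
          have hle : (N v).card ≤ (S \ T).card := Finset.card_le_card hN'
          have hkv' : (k : ℝ) ≤ (N v).card := by exact_mod_cast hkv
          calc _ = (1 - ((N v).card : ℝ) / (S \ T).card) ^ k := by
                convert mean_sample_disjoint (O := indepOracle M) h hN' k
            _ ≤ Real.exp (-((N v).card / (S \ T).card : ℝ)) ^ k := by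
                refine pow_le_pow_left₀ (sub_nonneg.2 ?_) (Real.one_sub_le_exp_neg _) k
                rw [div_le_one hm0]
                exact_mod_cast hle
            _ ≤ _ := by
                rw [← Real.exp_nat_mul, Real.exp_le_exp, mul_neg, neg_le_neg_iff, sq, mul_div_assoc]
                gcongr
        · rw [mean_const]
          positivity
    _ ≤ r * Real.exp (-((k : ℝ) ^ 2 / r)) := by
        rw [Finset.sum_const, nsmul_eq_mul, ← card_sdiff_eq_of_isBase hS hT]
        gcongr

variable [Fintype V]

theorem le_mean_swapAlong {f : Finset V → ℝ} (hf : IsSubmodular f) {C : Finset V}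
    {tb : V → V × V} (h : IsCirculation M S T C tb) {w b : ℝ} (hw : 0 ≤ w) (hb : 0 ≤ b)
    (hpq : p * w = (1 - p) * b) {y : V → ℝ} (hy : ∀ v, 0 ≤ y v) (hy' : ∀ v, w + b + y v ≤ 1)
    (O : Finset V → Bool) :
    multilinearExt f (w • charVec S + b • charVec T + y) ≤
      (swapAlong p hp S T C tb).mean O
        fun o _ => multilinearExt f (w • charVec o.1 + b • charVec o.2 + y) := by
  set x := w • charVec S + b • charVec T + y with hx
  have hchar : ∀ (A : Finset V) v, 0 ≤ charVec A v ∧ charVec A v ≤ 1 := fun A v => by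
    simp only [charVec]
    split_ifs <;> norm_num
  have h₀ : ∀ v, 0 ≤ x v := fun v => by
    simp only [hx, Pi.add_apply, Pi.smul_apply, smul_eq_mul]
    have := mul_nonneg hw (hchar S v).1
    have := mul_nonneg hb (hchar T v).1
    linarith [hy v]
  have h₁ : ∀ v, x v ≤ 1 := fun v => by
    simp only [hx, Pi.add_apply, Pi.smul_apply, smul_eq_mul]
    have := mul_le_mul_of_nonneg_left (hchar S v).2 hw
    have := mul_le_mul_of_nonneg_left (hchar T v).2 hb
    linarith [hy' v]
  have hp' : (p : ℝ) ≤ 1 := by exact_mod_cast hp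
  have hcard : (0 : ℝ) < C.card := by exact_mod_cast h.nonempty.card_pos
  rw [swapAlong, dif_pos h.nonempty, mean_bind, mean_uniformOn, le_div_iff₀ hcard]
  calc multilinearExt f x * C.card
      = ∑ u ∈ C, (multilinearExt f x + (1 - p) * b * (partialDiff f x u -
          partialDiff f x (tb u).2)) := by
        rw [Finset.sum_add_distrib, ← Finset.mul_sum, Finset.sum_sub_distrib,
          h.sum_eq (partialDiff f x)]
        simp [mul_comm]
    _ ≤ _ := by
        refine Finset.sum_le_sum fun u hu => ?_
        obtain ⟨m₁, m₂, m₃, -, -⟩ := h.isSwap u hu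
        rw [Finset.mem_sdiff] at m₁ m₂ m₃
        have e₁ : (tb u).2 ≠ (tb u).1 := fun e => m₂.2 (by rw [← e]; exact m₃.1)
        have e₂ : (tb u).1 ≠ u := fun e => m₂.2 (by rw [e]; exact m₁.1)
        have i₁ := multilinearExt_le_shift hf h₀ h₁ e₁ w
        have i₂ := multilinearExt_le_shift hf h₀ h₁ e₂ b
        simp only [mean, if_true, Bool.false_eq_true, if_false]
        rw [charVec_exchange m₃.1 m₂.2, charVec_exchange m₂.1 m₁.2]
        have r₁ : ∀ z : V → ℝ, w • (charVec S + z) + b • charVec T + y = x + w • z := fun z => by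
          rw [hx, smul_add]; abel
        have r₂ : ∀ z : V → ℝ, w • charVec S + b • (charVec T + z) + y = x + b • z := fun z => by
          rw [hx, smul_add]; abel
        rw [r₁, r₂]
        have j₁ := mul_le_mul_of_nonneg_left i₁ p.coe_nonneg
        have j₂ := mul_le_mul_of_nonneg_left i₂ (sub_nonneg.2 hp')
        refine le_trans (le_of_eq ?_) (add_le_add j₁ j₂)
        -- By the balance `p w = (1 - p) b` the derivative at `v` cancels, leaving the difference
        -- between `u` and `u'`, which sums to zero over `C`.
        linear_combination (partialDiff f x (tb u).2 - partialDiff f x (tb u).1) * hpq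

theorem le_mean_swapStep (hE : M.E = Set.univ) (hk : 0 < k)
    (hS : M.IsBase (S : Set V)) (hT : M.IsBase (T : Set V)) (h : (S \ T).Nonempty)
    {f : Finset V → ℝ} (hf : IsSubmodular f) {w b : ℝ} (hw : 0 ≤ w) (hb : 0 ≤ b)
    (hpq : p * w = (1 - p) * b) {y : V → ℝ} (hy : ∀ v, 0 ≤ y v) (hy' : ∀ v, w + b + y v ≤ 1) :
    multilinearExt f (w • charVec S + b • charVec T + y) ≤
      (swapStep k p hp S T).mean (indepOracle M)
        fun o _ => multilinearExt f (w • charVec o.1 + b • charVec o.2 + y) := by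
  rw [swapStep, dif_pos h, mean_bind]
  refine le_mean ((ensures_sample_toFinset hk h _).mono fun R n hR => ?_)
  rw [mean_bind]
  refine le_mean ((ensures_circulate (d := 0) hE hS hT hR.1 hR.2.1 le_rfl
    (card_sdiff_eq_of_isBase hS hT ▸ le_rfl)).mono fun C m hC => ?_)
  exact le_mean_swapAlong hf hC.1 hw hb hpq hy hy' _

end Step

end OracleAlg

/-! ### Merging all bases. -/

namespace OracleAlg

variable {V : Type*} [DecidableEq V] {M : Matroid V}

/-- Merge two bases in at most `n` steps. -/
noncomputable def merge (k : ℕ) (p : ℝ≥0) (hp : p ≤ 1) :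
    ℕ → Finset V → Finset V → OracleAlg (Finset V) (Finset V)
  | 0, S, _ => ret S
  | n + 1, S, T => (swapStep k p hp S T).bind fun o => merge k p hp n o.1 o.2

/-- The probability of changing the first of two bases with the coefficients `w` and `b`. -/
noncomputable def swapProb (w b : ℝ) : ℝ≥0 := min 1 (b / (w + b)).toNNReal

theorem swapProb_le_one (w b : ℝ) : swapProb w b ≤ 1 := min_le_left _ _

/-- For nonnegative weights the truncation at 1 in `swapProb` has no effect. If both weights vanish,
both sides are zero. -/
theorem swapProb_mul {w b : ℝ} (hw : 0 ≤ w) (hb : 0 ≤ b) :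
    swapProb w b * w = (1 - swapProb w b) * b := by
  have hle : b / (w + b) ≤ 1 := div_le_one_of_le₀ (by linarith) (by linarith)
  have hp : (swapProb w b : ℝ) = b / (w + b) := by
    rw [swapProb, min_eq_right (by simpa using hle), Real.coe_toNNReal _ (by positivity)]
  rw [hp]
  rcases (add_nonneg hw hb).eq_or_lt with h | h
  · have hw0 : w = 0 := by linarith
    have hb0 : b = 0 := by linarith
    simp [hw0, hb0]
  · field_simp
    ring

/-- Merge a base of coefficient `w` with the bases of a list, one after another. -/
noncomputable def mergeAll (k : ℕ) :
    List (ℝ × Finset V) → ℝ → Finset V → OracleAlg (Finset V) (Finset V)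
  | [], _, S => ret S
  | (b, T) :: L, w, S =>
    (merge k (swapProb w b) (swapProb_le_one w b) (S \ T).card S T).bind (mergeAll k L (w + b))

section Merge

variable {k r : ℕ} {p : ℝ≥0} {hp : p ≤ 1} {S T : Finset V}

theorem ensures_merge (hE : M.E = Set.univ) (hk : 0 < k) (n : ℕ) (hS : M.IsBase (S : Set V))
    (hT : M.IsBase (T : Set V)) (hn : (S \ T).card = n) :
    (merge k p hp n S T).Ensures (indepOracle M) fun o _ => M.IsBase (o : Set V) := by
  induction n generalizing S T with
  | zero => exact hS
  | succ n ih =>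
    refine Ensures.bind ((ensures_swapStep hE hk hS hT (Finset.card_pos.1 (by omega))).mono ?_)
    rintro o m ⟨h₁, h₂, h₃⟩
    exact ih h₁ h₂ (by omega)

omit [DecidableEq V] in
theorem card_eq_of_isBase (hS : M.IsBase (S : Set V)) (hT : M.IsBase (T : Set V)) :
    S.card = T.card := by
  simpa using hS.ncard_eq_ncard_of_isBase hT

theorem overrun_merge (hE : M.E = Set.univ) (hk : 0 < k) (n : ℕ) (hS : M.IsBase (S : Set V))
    (hT : M.IsBase (T : Set V)) (hr : S.card = r) (hn : (S \ T).card = n) :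
    (merge k p hp n S T).overrun (indepOracle M) (n * (k * (3 * Nat.clog 2 r + 4))) ≤
      n * (r * Real.exp (-((k : ℝ) ^ 2 / r))) := by
  induction n generalizing S T with
  | zero => simp [merge, overrun, mean]
  | succ n ih =>
    have hne : (S \ T).Nonempty := Finset.card_pos.1 (by omega)
    rw [merge, add_mul, one_mul, add_comm]
    refine (overrun_bind_le (ε := n * (r * Real.exp (-((k : ℝ) ^ 2 / r)))) (by positivity)
      ((ensures_swapStep hE hk hS hT hne).mono ?_)).trans ?_
    · rintro o m ⟨h₁, h₂, h₃⟩
      exact ih h₁ h₂ (card_eq_of_isBase h₁ hS ▸ hr) (by omega)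
    · have := overrun_swapStep (p := p) (hp := hp) hE hk hS hT hr hne
      push_cast
      linarith

theorem ensures_mergeAll (hE : M.E = Set.univ) (hk : 0 < k) (L : List (ℝ × Finset V)) (w : ℝ)
    (hS : M.IsBase (S : Set V)) (hL : ∀ q ∈ L, M.IsBase (q.2 : Set V)) :
    (mergeAll k L w S).Ensures (indepOracle M) fun o _ => M.IsBase (o : Set V) := by
  induction L generalizing w S with
  | nil => exact hS
  | cons q L ih =>
    rw [List.forall_mem_cons] at hL
    exact Ensures.bind ((ensures_merge hE hk _ hS hL.1 rfl).mono fun o _ ho => ih _ ho hL.2)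

theorem overrun_mergeAll (hE : M.E = Set.univ) (hk : 0 < k) (L : List (ℝ × Finset V)) (w : ℝ)
    (hS : M.IsBase (S : Set V)) (hL : ∀ q ∈ L, M.IsBase (q.2 : Set V)) (hr : S.card = r) :
    (mergeAll k L w S).overrun (indepOracle M)
        (L.length * (r * (k * (3 * Nat.clog 2 r + 4)))) ≤
      L.length * (r * (r * Real.exp (-((k : ℝ) ^ 2 / r)))) := by
  induction L generalizing w S with
  | nil => simp [mergeAll, overrun, mean]
  | cons q L ih =>
    rw [List.forall_mem_cons] at hL
    have hle : (S \ q.2).card ≤ r := hr ▸ Finset.card_le_card Finset.sdiff_subset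
    have hle' : ((S \ q.2).card : ℝ) ≤ r := by exact_mod_cast hle
    rw [mergeAll, List.length_cons, add_mul, one_mul, add_comm (L.length * _)]
    refine (overrun_bind_le (ε := L.length * (r * (r * Real.exp (-((k : ℝ) ^ 2 / r)))))
      (by positivity) ((ensures_merge hE hk _ hS hL.1 rfl).mono fun o _ ho =>
        ih _ ho hL.2 (card_eq_of_isBase ho hS ▸ hr))).trans ?_
    have h₁ : (merge k (swapProb w q.1) (swapProb_le_one w q.1) (S \ q.2).card S q.2).overrun
        (indepOracle M) (r * (k * (3 * Nat.clog 2 r + 4))) ≤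
          r * (r * Real.exp (-((k : ℝ) ^ 2 / r))) :=
      (overrun_anti (Nat.mul_le_mul_right _ hle)).trans ((overrun_merge hE hk _ hS hL.1 hr rfl).trans
        (mul_le_mul_of_nonneg_right hle' (by positivity)))
    push_cast
    linarith

variable [Fintype V]

theorem le_mean_merge (hE : M.E = Set.univ) (hk : 0 < k) (n : ℕ) (hS : M.IsBase (S : Set V))
    (hT : M.IsBase (T : Set V)) (hn : (S \ T).card = n)
    {f : Finset V → ℝ} (hf : IsSubmodular f) {w b : ℝ} (hw : 0 ≤ w) (hb : 0 ≤ b)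
    (hpq : p * w = (1 - p) * b) {y : V → ℝ} (hy : ∀ v, 0 ≤ y v) (hy' : ∀ v, w + b + y v ≤ 1) :
    multilinearExt f (w • charVec S + b • charVec T + y) ≤
      (merge k p hp n S T).mean (indepOracle M)
        fun o _ => multilinearExt f ((w + b) • charVec o + y) := by
  induction n generalizing S T with
  | zero =>
    have hST : S = T := Finset.eq_of_subset_of_card_le
      (Finset.sdiff_eq_empty_iff_subset.1 (Finset.card_eq_zero.1 hn)) (card_eq_of_isBase hT hS).le
    rw [merge, mean, hST, add_smul]
  | succ n ih =>
    have hne : (S \ T).Nonempty := Finset.card_pos.1 (by omega)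
    rw [merge, mean_bind]
    refine (le_mean_swapStep hE hk hS hT hne hf hw hb hpq hy hy').trans
      (mean_mono ((ensures_swapStep hE hk hS hT hne).mono ?_))
    rintro o m ⟨h₁, h₂, h₃⟩
    exact ih h₁ h₂ (by omega)

theorem le_mean_mergeAll (hE : M.E = Set.univ) (hk : 0 < k) (L : List (ℝ × Finset V)) {w : ℝ}
    (hw : 0 ≤ w) (hS : M.IsBase (S : Set V)) (hL : ∀ q ∈ L, M.IsBase (q.2 : Set V) ∧ 0 ≤ q.1)
    (hsum : w + (L.map Prod.fst).sum = 1) {f : Finset V → ℝ} (hf : IsSubmodular f) :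
    multilinearExt f (w • charVec S + (L.map fun q => q.1 • charVec q.2).sum) ≤
      (mergeAll k L w S).mean (indepOracle M) fun o _ => f o := by
  induction L generalizing w S with
  | nil =>
    have hw1 : w = 1 := by simpa using hsum
    simp [mergeAll, mean, hw1, multilinearExt_charVec]
  | cons q L ih =>
    rw [List.forall_mem_cons] at hL
    simp only [List.map_cons, List.sum_cons, ← add_assoc] at hsum ⊢
    -- The bases not yet merged contribute at most their total weight to each coordinate, which
    -- keeps the current point in the cube.
    have hy : ∀ v, 0 ≤ (L.map fun q => q.1 • charVec q.2).sum v ∧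
        (L.map fun q => q.1 • charVec q.2).sum v ≤ (L.map Prod.fst).sum := by
      intro v
      have hL' := hL.2
      clear hsum ih
      induction L with
      | nil => simp
      | cons q' L ih =>
        rw [List.forall_mem_cons] at hL'
        obtain ⟨i₁, i₂⟩ := ih ⟨hL.1, hL'.2⟩ hL'.2
        have h := hL'.1.2
        have hc : 0 ≤ q'.1 * charVec q'.2 v ∧ q'.1 * charVec q'.2 v ≤ q'.1 := by
          simp only [charVec]
          split_ifs <;> simp [h]
        simp only [List.map_cons, List.sum_cons, Pi.add_apply, Pi.smul_apply, smul_eq_mul]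
        exact ⟨add_nonneg hc.1 i₁, add_le_add hc.2 i₂⟩
    rw [mergeAll, mean_bind]
    refine (le_mean_merge hE hk _ hS hL.1.1 rfl hf hw hL.1.2 (swapProb_mul hw hL.1.2)
      (fun v => (hy v).1) (fun v => (add_le_add_right (hy v).2 _).trans hsum.le)).trans
      (mean_mono ((ensures_merge hE hk _ hS hL.1.1 rfl).mono fun o _ ho => ?_))
    exact ih (add_nonneg hw hL.1.2) ho hL.2 hsum

end Merge

/-- The number of samples drawn in each step. -/
noncomputable def sampleSize (r t : ℕ) : ℕ := ⌈√(3 * r * Real.log (r * t))⌉₊ + 1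

/-- Merge all bases of a convex combination, with the sample size that fits their cardinality. -/
noncomputable def rounding (t : ℕ) (B : Fin t → Finset V) (β : Fin t → ℝ) :
    OracleAlg (Finset V) (Finset V) :=
  if h : 0 < t then
    -- The starting basis has weight 0 and stays in the list: merging it with itself takes no step
    -- and gives it its coefficient.
    mergeAll (sampleSize (B ⟨0, h⟩).card t) (List.ofFn fun i => (β i, B i)) 0 (B ⟨0, h⟩)
  else ret ∅

/-! ### Numerical estimates for the sample size. -/

section Bounds

variable {r t : ℕ}

/-- The factor 3 in `sampleSize` gives `exp(-k²/r) ≤ (rt)⁻³`, and `r² t (rt)⁻³ = (rt)⁻¹ t⁻¹`. -/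
theorem failure_bound (hr : 1 ≤ r) (ht : 1 ≤ t) :
    (t : ℝ) * (r * (r * Real.exp (-((sampleSize r t : ℝ) ^ 2 / r)))) ≤ ((r : ℝ) * t)⁻¹ := by
  have hr' : (1 : ℝ) ≤ r := by exact_mod_cast hr
  have ht' : (1 : ℝ) ≤ t := by exact_mod_cast ht
  have hrt : (1 : ℝ) ≤ r * t := by nlinarith
  have hlog := Real.log_nonneg hrt
  have hk : √(3 * r * Real.log (r * t)) ≤ sampleSize r t := by
    rw [sampleSize]
    push_cast
    linarith [Nat.le_ceil √(3 * r * Real.log (r * t))]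
  have hk2 : 3 * Real.log (r * t) ≤ (sampleSize r t : ℝ) ^ 2 / r := by
    rw [le_div_iff₀ (by linarith)]
    have := pow_le_pow_left₀ (Real.sqrt_nonneg _) hk 2
    rw [Real.sq_sqrt (by positivity)] at this
    linarith
  have hexp : Real.exp (-((sampleSize r t : ℝ) ^ 2 / r)) ≤ (((r : ℝ) * t) ^ 3)⁻¹ := by
    calc _ ≤ Real.exp (-(3 * Real.log (r * t))) := Real.exp_le_exp.2 (by linarith)
      _ = _ := by
        rw [Real.exp_neg, show (3 : ℝ) * Real.log (r * t) = (3 : ℕ) * Real.log (r * t) by norm_num,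
          Real.exp_nat_mul, Real.exp_log (by linarith)]
  calc (t : ℝ) * (r * (r * Real.exp (-((sampleSize r t : ℝ) ^ 2 / r))))
      ≤ t * (r * (r * (((r : ℝ) * t) ^ 3)⁻¹)) := by gcongr
    _ = ((r : ℝ) * t)⁻¹ * (t : ℝ)⁻¹ := by field_simp
    _ ≤ ((r : ℝ) * t)⁻¹ := mul_le_of_le_one_right (by positivity) (inv_le_one_of_one_le₀ ht')

theorem query_bound (hr : 1 ≤ r) (ht : 1 ≤ t) (hrt : 2 ≤ r * t) :
    ((t * (r * (sampleSize r t * (3 * Nat.clog 2 r + 4))) : ℕ) : ℝ) ≤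
      100 * ((r : ℝ) ^ (3 / 2 : ℝ) * t * Real.log (r * t) ^ (3 / 2 : ℝ)) := by
  have hr' : (1 : ℝ) ≤ r := by exact_mod_cast hr
  have ht' : (1 : ℝ) ≤ t := by exact_mod_cast ht
  have hrt' : (2 : ℝ) ≤ r * t := by exact_mod_cast hrt
  set l := Real.log (r * t) with hl_def
  -- As `l ≥ log 2`, additive constants are absorbed into multiples of `l`: `1 ≤ 1.45 l` and `4 ≤ 6
  -- l`. Likewise `2 ≤ 2.5 √(r l)`.
  have hlog2 : (0.69 : ℝ) ≤ Real.log 2 := by linarith [Real.log_two_gt_d9]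
  have hl : 0.69 ≤ l := hlog2.trans (Real.log_le_log (by norm_num) hrt')
  have hl0 : 0 ≤ l := by linarith
  have hr0 : (0 : ℝ) ≤ r := by linarith
  have hclog : (Nat.clog 2 r : ℝ) ≤ 3 * l := by
    have h₁ : (Nat.clog 2 r : ℝ) < Real.logb 2 r + 1 := by
      rw [← Real.natCeil_logb_natCast]
      exact Nat.ceil_lt_add_one (Real.logb_nonneg (by norm_num) hr')
    have h₂ : Real.logb 2 r ≤ l / 0.69 := by
      rw [Real.logb]
      exact div_le_div₀ hl0 (Real.log_le_log (by linarith) (by nlinarith)) (by norm_num) hlog2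
    have h₃ : l / 0.69 ≤ 1.45 * l := by
      rw [div_le_iff₀ (by norm_num)]
      nlinarith
    linarith
  have hs : 0.8 ≤ √(r * l) := by
    rw [Real.le_sqrt' (by norm_num)]
    nlinarith
  have hk : (sampleSize r t : ℝ) ≤ 5 * √(r * l) := by
    have h₁ : √(3 * r * l) ≤ 1.75 * √(r * l) := by
      rw [mul_assoc, Real.sqrt_mul (by norm_num)]
      gcongr
      rw [Real.sqrt_le_left (by norm_num)]
      norm_num
    have h₂ := Nat.ceil_lt_add_one (Real.sqrt_nonneg (3 * r * l))
    rw [sampleSize]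
    push_cast
    linarith
  have hpow : ∀ a : ℝ, 0 ≤ a → a ^ (3 / 2 : ℝ) = a * √a := by
    intro a ha
    rw [Real.sqrt_eq_rpow, ← Real.rpow_one_add' ha (by norm_num)]
    norm_num
  rw [hpow _ hr0, hpow _ hl0]
  push_cast
  calc (t : ℝ) * (r * (sampleSize r t * (3 * Nat.clog 2 r + 4)))
      ≤ t * (r * (5 * √(r * l) * (3 * (3 * l) + 6 * l))) := by
        gcongr
        linarith
    _ = 75 * (r * √r * t * (l * √l)) := by
        rw [Real.sqrt_mul hr0]
        ring
    _ ≤ 100 * (r * √r * t * (l * √l)) := by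
        gcongr
        norm_num

end Bounds

end OracleAlg

/-! ### The theorem. -/

open OracleAlg in
theorem theorem5p1 :
    ∃ (A : RoundingAlg.{u}) (C : ℝ),
      ∀ (V : Type u) [Fintype V] [DecidableEq V] (M : Matroid V) (_ : M.E = Set.univ)
        (t : ℕ) (B : Fin t → Finset V) (β : Fin t → ℝ)
        (_ : ∀ i, M.IsBase (B i : Set V)) (_ : ∀ i, 0 ≤ β i) (_ : ∑ i, β i = 1),
        (∀ o ∈ ((A V t B β).run (indepOracle M)).support, M.IsBase (o.1 : Set V)) ∧
        (∀ f : Finset V → ℝ, IsSubmodular f →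
          multilinearExt f (∑ i, β i • charVec (B i)) ≤
            finExpectation ((A V t B β).output (indepOracle M)) f) ∧
        (∀ r : ℕ, (r : ℕ∞) = M.eRank → 1 ≤ r →
          1 - ((r : ℝ) * t)⁻¹ ≤
            (((A V t B β).run (indepOracle M)).toOuterMeasure
              {o | (o.2 : ℝ) ≤
                C * ((r : ℝ) ^ (3 / 2 : ℝ) * t * Real.log (r * t) ^ (3 / 2 : ℝ))}).toReal) := by
  refine ⟨fun V _ _ t B β => rounding t B β, 100, fun V _ _ M hE t B β hB hβ hsum => ?_⟩
  have ht : 0 < t := by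
    rcases Nat.eq_zero_or_pos t with rfl | h
    · simp at hsum
    · exact h
  set S := B ⟨0, ht⟩ with hS_def
  have hS : M.IsBase (S : Set V) := hB _
  have hk : 0 < sampleSize S.card t := Nat.succ_pos _
  have hA : rounding t B β =
      mergeAll (sampleSize S.card t) (List.ofFn fun i => (β i, B i)) 0 S := dif_pos ht
  have hL : ∀ q ∈ List.ofFn fun i => (β i, B i), M.IsBase (q.2 : Set V) ∧ 0 ≤ q.1 := by
    simp only [List.mem_ofFn]
    rintro _ ⟨i, rfl⟩
    exact ⟨hB i, hβ i⟩
  simp only [hA]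
  refine ⟨?_, fun f hf => ?_, fun r hr hr1 => ?_⟩
  · exact (ensures_mergeAll hE hk _ _ hS fun q hq => (hL q hq).1).of_mem_support
  · rw [finExpectation_output]
    have h := le_mean_mergeAll hE hk _ le_rfl hS hL
      (by simp [List.map_ofFn, List.sum_ofFn, hsum]) hf
    simpa [List.map_ofFn, List.sum_ofFn] using h
  · obtain rfl : S.card = r := by
      have h := hS.encard_eq_eRank
      rw [← hr, Set.encard_coe_eq_coe_finsetCard] at h
      exact_mod_cast h
    -- For `rt = 1` the logarithm vanishes, but the required probability is `0`.
    rcases Nat.lt_or_ge (S.card * t) 2 with h1 | h2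
    · have : S.card * t = 1 := by nlinarith
      have : (S.card : ℝ) * t = 1 := by exact_mod_cast this
      rw [this]
      simp
    · refine le_trans ?_ (one_sub_overrun_le
        (K := t * (S.card * (sampleSize S.card t * (3 * Nat.clog 2 S.card + 4)))) fun o ho => ?_)
      · have h := overrun_mergeAll hE hk (List.ofFn fun i => (β i, B i)) 0 hS
          (fun q hq => (hL q hq).1) rfl
        rw [List.length_ofFn] at h
        linarith [failure_bound hr1 ht]
      · exact le_trans (by exact_mod_cast ho) (query_bound hr1 ht h2)
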